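/- Let $\mathcal A_3=\{1,2,3\}$, let $\Sigma_3$ be the symmetric group on $\mathcal A_3$ (each permutation is identified with the morphism of the free monoid $\mathcal A_3^*$ that it induces), and let $\mathcal S_3=\{\alpha,\beta,\gamma,\eta\}\cup\{\delta^{(k)},\zeta^{(k)} : k\ge 1\}$, where the morphisms map $(1,2,3)$ as follows: $$\alpha:(1,\,12,\,13),\quad \beta:(1,\,12,\,132),\quad \gamma:(1,\,12,\,123),\quad \eta:(13,\,12,\,123),$$ $$\delta^{(k)}:(1,\,123^k,\,123^{k+1}),\qquad \zeta^{(k)}:(13^k,\,12,\,13^{k+1}).$$ Let $\Sigma_3\mathcal S_3\Sigma_3$ be the set of morphisms $\pi\circ s\circ\pi'$ with $\pi,\pi'\in\Sigma_3$ and $s\in\mathcal S_3$. For a sequence $\boldsymbol\sigma=(\sigma_n)_{n\ge1}$ of morphisms in this set put $\sigma_{[n,N)}=\sigma_n\circ\cdots\circ\sigma_{N-1}$, and let $X^{(n)}_{\boldsymbol\sigma}\subseteq\mathcal A_3^{\mathbb Z}$ be the set of bi-infinite words all of whose finite factors occur in $\sigma_{[n,N)}(a)$ for some $N>n$ and some letter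 $a$ (depending on the factor). The sequence $\boldsymbol\sigma$ is called a $\Sigma_3\mathcal S_3\Sigma_3$-adic representation of the shift space $X$ if $X=X^{(1)}_{\boldsymbol\sigma}$. **Proposition.** Let $X\subseteq\mathcal A_3^{\mathbb Z}$ be a shift space that has at least one $\Sigma_3\mathcal S_3\Sigma_3$-adic representation $\boldsymbol\rho$ such that, for every $n\ge 1$, all three letters occur in $X^{(n)}_{\boldsymbol\rho}$ (for instance a primitive representation: for every $n$ there is $N>n$ such that every letter occurs in $\rho_{[n,N)}(a)$ for every letter $a$). Then any two $\Sigma_3\mathcal S_3\Sigma_3$-adic representations $\boldsymbol\sigma$ and $\boldsymbol\tau$ of $X$ are equivalent: for every $n\ge 1$ there is a permutation $\xi_n\in\Sigma_3$ with $$\sigma_1\circ\cdots\circ\sigma_n\circ\xi_n=\tau_1\circ\cdots\circ\tau_n .$$ Moreover, if $\sigma_n=\pi_n s_n\pi_n'$ and $\tau_n=\psi_n t_n\psi_n'$ with $\pi_n,\pi'_n,\psi_n,\psi'_n\in\Sigma_3$ and $s_n,t_n\in\mathcal S_3$ for all $n$, then $s_n=t_n$ for all $n$. -/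

import Mathlib

namespace SAdic

section General

variable {A : Type*}

/-- An endomorphism of the free monoid `A*` over the alphabet `A`. In `Monoid.End` multiplication
is composition: `(σ * τ) w = σ (τ w)`. -/
abbrev Morphism (A : Type*) : Type _ := Monoid.End (FreeMonoid A)

/-- `u` occurs in `w`, i.e. `w = p u s` for some words `p`, `s`. -/
def IsFactor (u w : FreeMonoid A) : Prop :=
  FreeMonoid.toList u <:+: FreeMonoid.toList w

/-- The word `x_i x_{i+1} ⋯ x_{i+m-1}` of a bi-infinite word `x`. -/
def window (x : ℤ → A) (i : ℤ) (m : ℕ) : FreeMonoid A :=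
  FreeMonoid.ofList (List.ofFn fun j : Fin m => x (i + (j : ℤ)))

/-- The language of `x`: its set of (finite) factors. -/
def language (x : ℤ → A) : Set (FreeMonoid A) :=
  {w | ∃ (i : ℤ) (m : ℕ), w = window x i m}

/-- `X ⊆ A^ℤ` is over the alphabet `A`: all letters of `A` occur in `X`. -/
def IsOver (X : Set (ℤ → A)) : Prop :=
  ∀ a : A, ∃ x ∈ X, FreeMonoid.of a ∈ language x

/-- `block σ n k` is the composition `σ_n ∘ σ_{n+1} ∘ ⋯ ∘ σ_{n+k-1}` of `k` consecutive morphisms,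
usually written `σ_{[n, n+k)}`. -/
def block (σ : ℕ → Morphism A) (n : ℕ) : ℕ → Morphism A
  | 0 => 1
  | k + 1 => block σ n k * σ (n + k)

/-- The language of level `n` of `σ`: the words that occur in `σ_{[n, N)}(a)` for some letter `a`
and some `N > n`. -/
def levelLanguage (σ : ℕ → Morphism A) (n : ℕ) : Set (FreeMonoid A) :=
  {w | ∃ N, n < N ∧ ∃ a : A, IsFactor w (block σ n (N - n) (FreeMonoid.of a))}

/-- The shift space of level `n` of `σ`: the bi-infinite words all of whose factors belong to the
language of level `n`. -/
def levelShift (σ : ℕ → Morphism A) (n : ℕ) : Set (ℤ → A) :=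
  {x | language x ⊆ levelLanguage σ n}

/-- Directive sequences over the single finite alphabet `A`, indexed from `0` (so that `σ 0`,
`σ 1`, … are the first, second, … morphisms): all morphisms are non-erasing, the alphabets are
minimal (each letter occurs in an image of a letter) and the largest length of the image of a
letter under `σ 0 ∘ ⋯ ∘ σ (n-1)` tends to infinity with `n`. -/
structure IsDirective [Fintype A] (σ : ℕ → Morphism A) : Prop where
  nonerasing : ∀ n a, σ n (FreeMonoid.of a) ≠ 1
  minimal : ∀ n b, ∃ a, IsFactor (FreeMonoid.of b) (σ n (FreeMonoid.of a))
  growing : Filter.Tendsto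
    (fun n => Finset.univ.sup fun a : A => (block σ 0 n (FreeMonoid.of a)).length)
    Filter.atTop Filter.atTop

/-- `σ` is an `S`-adic representation of `X`. -/
structure IsRepresentation [Fintype A] (S : Set (Morphism A)) (σ : ℕ → Morphism A)
    (X : Set (ℤ → A)) : Prop where
  mem : ∀ n, σ n ∈ S
  directive : IsDirective σ
  eq_shift : X = levelShift σ 0

/-- The morphism that a permutation of the alphabet induces. -/
def permMorphism (π : Equiv.Perm A) : Morphism A := FreeMonoid.map π

/-- Two sequences of morphisms are equivalent if, for all `n`, the products of their first `n`
morphisms agree up to composition on the right with a permutation of the alphabet. -/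
def Equivalent (σ τ : ℕ → Morphism A) : Prop :=
  ∀ n, ∃ π : Equiv.Perm A, block σ 0 n * permMorphism π = block τ 0 n

end General

section Ternary

/-- The three-letter alphabet; its letters `0`, `1`, `2` stand for `1`, `2`, `3`, see
`x1`, `x2`, `x3`. -/
abbrev A3 : Type := Fin 3

/-- The letter `1`, as a word. -/
def x1 : FreeMonoid A3 := FreeMonoid.of 0

/-- The letter `2`, as a word. -/
def x2 : FreeMonoid A3 := FreeMonoid.of 1

/-- The letter `3`, as a word. -/
def x3 : FreeMonoid A3 := FreeMonoid.of 2

/-- The morphism `1 ↦ u`, `2 ↦ v`, `3 ↦ w`. -/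
def morphism3 (u v w : FreeMonoid A3) : Morphism A3 :=
  FreeMonoid.lift ![u, v, w]

/-- `1 ↦ 1`, `2 ↦ 12`, `3 ↦ 13`. -/
def alpha : Morphism A3 := morphism3 x1 (x1 * x2) (x1 * x3)

/-- `1 ↦ 1`, `2 ↦ 12`, `3 ↦ 132`. -/
def beta : Morphism A3 := morphism3 x1 (x1 * x2) (x1 * x3 * x2)

/-- `1 ↦ 1`, `2 ↦ 12`, `3 ↦ 123`. -/
def gamma : Morphism A3 := morphism3 x1 (x1 * x2) (x1 * x2 * x3)

/-- `1 ↦ 1`, `2 ↦ 123^k`, `3 ↦ 123^(k+1)`. -/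
def delta (k : ℕ) : Morphism A3 :=
  morphism3 x1 (x1 * x2 * x3 ^ k) (x1 * x2 * x3 ^ (k + 1))

/-- `1 ↦ 13^k`, `2 ↦ 12`, `3 ↦ 13^(k+1)`. -/
def zeta (k : ℕ) : Morphism A3 :=
  morphism3 (x1 * x3 ^ k) (x1 * x2) (x1 * x3 ^ (k + 1))

/-- `1 ↦ 13`, `2 ↦ 12`, `3 ↦ 123`. -/
def eta : Morphism A3 := morphism3 (x1 * x3) (x1 * x2) (x1 * x2 * x3)

/-- The set `𝒮₃` of return morphisms. -/
def S3 : Set (Morphism A3) :=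
  {alpha, beta, gamma, eta} ∪ {s | ∃ k : ℕ, 1 ≤ k ∧ (s = delta k ∨ s = zeta k)}

/-- The set `Σ₃ 𝒮₃ Σ₃` of all compositions `π ∘ s ∘ π'` with `s ∈ 𝒮₃` and permutations `π`, `π'`
of the alphabet. -/
def permS3perm : Set (Morphism A3) :=
  {f | ∃ (π π' : Equiv.Perm A3), ∃ s ∈ S3, f = permMorphism π * s * permMorphism π'}

end Ternary

end SAdic

/-!
Every morphism of `permS3perm` has a *marker*: the image of each letter begins with one and the
same letter, which does not occur elsewhere in it (`IsMarked`). Cutting before the markers recovers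
a word from its image, so if `f u`, followed by the marker, is a factor of `f v`, then `u` is a
factor of `v` (`IsMarked.isFactor_of_isFactor`). Together with the existence of images of
bi-infinite words (`exists_image`) this shows that a bi-infinite word has level `n + 1` if and only
if it has an image of level `n` (`exists_image_mem_levelShift`, `mem_levelShift_succ`). Hence the
shift of level `n` and the morphism of level `n` determine the shift of level `n + 1`, and it
remains to see that the shift of level `n` determines the morphism, up to a permutation on the
right.

Let `ρ` be a representation all of whose levels are over the full alphabet, and let `σ` be any
representation. In the shift of level `n` of `ρ = π s π'`, the image of every letter occurs,
followed by the marker, so all two-letter words of `s(c) 1` occur, renamed by `π`. There are five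
of them for each `s` in `S3`, and all two-letter factors of images under `s` are among these. So if
`σ = ψ t ψ'` has the same shift of level `n` up to a permutation, the five two-letter words of `s`
are mapped into the five of `t` by a permutation `θ` of the letters. A finite check
(`Kind.eq_of_pairs_subset`) shows that `s` and `t` have the same shape and that `θ` is trivial, or
that both are `alpha` and `θ` exchanges `2` and `3`, which commutes with `alpha`. The exponents of
`delta` and `zeta` are then found by comparing the images of the letters (`Kind.eq_exponent`). No
assumption on the letters in the levels of `σ` is needed, so any two representations can be compared
with `ρ`, by induction on the level (`exists_perm_levelShift_succ`).
-/

namespace SAdic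

/-! ### Factors, windows and permutations of the letters -/

section Words

variable {A : Type*}

theorem Morphism.mul_apply (f g : Morphism A) (w : FreeMonoid A) : (f * g) w = f (g w) := rfl

theorem isFactor_of_eq {u w p q : FreeMonoid A} (h : w = p * u * q) : IsFactor u w :=
  ⟨FreeMonoid.toList p, FreeMonoid.toList q, by rw [h]; rfl⟩

theorem IsFactor.exists_eq {u w : FreeMonoid A} (h : IsFactor u w) : ∃ p q, w = p * u * q := by
  obtain ⟨p, q, h⟩ := h
  exact ⟨FreeMonoid.ofList p, FreeMonoid.ofList q, h.symm⟩

theorem IsFactor.trans {u v w : FreeMonoid A} (h : IsFactor u v) (h' : IsFactor v w) :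
    IsFactor u w :=
  List.IsInfix.trans h h'

theorem IsFactor.map {u w : FreeMonoid A} (h : IsFactor u w) (f : Morphism A) :
    IsFactor (f u) (f w) := by
  obtain ⟨p, q, rfl⟩ := h.exists_eq
  exact isFactor_of_eq (by rw [map_mul, map_mul])

theorem of_mul_inj {a b : A} {u v : FreeMonoid A}
    (h : FreeMonoid.of a * u = FreeMonoid.of b * v) : a = b ∧ u = v :=
  List.cons.inj h

theorem of_mul_ne_one (a : A) (u : FreeMonoid A) : FreeMonoid.of a * u ≠ 1 :=
  List.cons_ne_nil _ _

theorem mem_mul_of_mul (a : A) (u v : FreeMonoid A) :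
    a ∈ FreeMonoid.toList (u * (FreeMonoid.of a * v)) :=
  List.mem_append_right _ List.mem_cons_self

theorem exists_of_mul_eq_mul {u v w z : FreeMonoid A} (h : u * v = w * z) :
    (∃ r, w = u * r ∧ v = r * z) ∨ ∃ r, u = w * r ∧ z = r * v :=
  List.append_eq_append_iff.1 h

theorem window_add (x : ℤ → A) (i : ℤ) (m k : ℕ) :
    window x i (m + k) = window x i m * window x (i + m) k := by
  refine (congrArg FreeMonoid.ofList
    (List.ofFn_add (f := fun j : Fin (m + k) => x (i + (j : ℤ))))).trans ?_
  simp [window, FreeMonoid.ofList_append, add_assoc]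

theorem window_one (x : ℤ → A) (i : ℤ) : window x i 1 = FreeMonoid.of (x i) := by
  simp [window]

theorem window_succ (x : ℤ → A) (i : ℤ) (m : ℕ) :
    window x i (m + 1) = window x i m * FreeMonoid.of (x (i + m)) := by
  rw [window_add, window_one]

theorem toList_permMorphism (π : Equiv.Perm A) (w : FreeMonoid A) :
    FreeMonoid.toList (permMorphism π w) = (FreeMonoid.toList w).map π := rfl

theorem window_zero (x : ℤ → A) (i : ℤ) : window x i 0 = 1 := rfl

theorem window_comp (π : Equiv.Perm A) (x : ℤ → A) (i : ℤ) (m : ℕ) :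
    window (π ∘ x) i m = permMorphism π (window x i m) := by
  apply FreeMonoid.toList.injective
  rw [toList_permMorphism]
  simp only [window, FreeMonoid.toList_ofList, List.map_ofFn]
  rfl

theorem exists_eq_of_mem_language {a : A} {x : ℤ → A} (h : FreeMonoid.of a ∈ language x) :
    ∃ i, x i = a := by
  obtain ⟨i, m, h⟩ := h
  have hm : 1 = m := by
    have := congrArg FreeMonoid.length h
    simpa [window, FreeMonoid.length] using this
  subst hm
  rw [window_one] at h
  exact ⟨i, (FreeMonoid.of_injective h).symm⟩

theorem permMorphism_of (π : Equiv.Perm A) (a : A) :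
    permMorphism π (FreeMonoid.of a) = FreeMonoid.of (π a) := rfl

theorem permMorphism_mul (π π' : Equiv.Perm A) :
    permMorphism (π * π') = permMorphism π * permMorphism π' :=
  FreeMonoid.hom_eq fun _ => rfl

theorem permMorphism_one : permMorphism (1 : Equiv.Perm A) = 1 :=
  FreeMonoid.hom_eq fun _ => rfl

theorem permMorphism_inv_mul (π : Equiv.Perm A) : permMorphism π⁻¹ * permMorphism π = 1 := by
  rw [← permMorphism_mul, inv_mul_cancel, permMorphism_one]

theorem permMorphism_mul_inv (π : Equiv.Perm A) : permMorphism π * permMorphism π⁻¹ = 1 := by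
  rw [← permMorphism_mul, mul_inv_cancel, permMorphism_one]

theorem permMorphism_inv_apply (π : Equiv.Perm A) (w : FreeMonoid A) :
    permMorphism π⁻¹ (permMorphism π w) = w :=
  DFunLike.congr_fun (permMorphism_inv_mul π) w

end Words

/-! ### The image of a bi-infinite word under a morphism -/

section Image

variable {A : Type*}

theorem exists_forall_succ_eq_add (d : ℤ → ℤ) : ∃ c : ℤ → ℤ, ∀ n, c (n + 1) = c n + d n := by
  refine ⟨fun n => ∑ i ∈ Finset.Ico 0 n, d i - ∑ i ∈ Finset.Ico n 0, d i, fun n => ?_⟩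
  rcases le_or_gt 0 n with h | h
  · have : Finset.Ico 0 (n + 1) = insert n (Finset.Ico 0 n) := by ext; simp; omega
    simp [this, Finset.Ico_eq_empty_of_le h,
      Finset.Ico_eq_empty_of_le (show (0 : ℤ) ≤ n + 1 by omega)]
    ring
  · have : Finset.Ico n 0 = insert n (Finset.Ico (n + 1) 0) := by ext; simp; omega
    simp [this, Finset.Ico_eq_empty_of_le h.le,
      Finset.Ico_eq_empty_of_le (show n + 1 ≤ (0 : ℤ) by omega)]

/-- A bi-infinite word `y` has an image under a non-erasing morphism `f`: a bi-infinite word that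
is the concatenation of the words `f (y i)`. -/
theorem exists_image {f : Morphism A} (hf : ∀ a, f (FreeMonoid.of a) ≠ 1) (y : ℤ → A) :
    ∃ x : ℤ → A, (∀ i m, f (window y i m) ∈ language x) ∧
      ∀ w ∈ language x, ∃ i m, IsFactor w (f (window y i m)) := by
  -- `c n` is the position at which the word `f (y n)` begins.
  obtain ⟨c, hc⟩ := exists_forall_succ_eq_add fun n => ((f (FreeMonoid.of (y n))).length : ℤ)
  have hpos (a : A) : 0 < (f (FreeMonoid.of a)).length := by
    rw [Nat.pos_iff_ne_zero, Ne, FreeMonoid.length_eq_zero]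
    exact hf a
  have hmono : StrictMono c := strictMono_int_of_lt_succ fun n => by
    have := hpos (y n)
    have := hc n
    omega
  have hmono' : Monotone fun n => c n - n := monotone_int_of_le_succ fun n => by
    have := hpos (y n)
    have := hc n
    omega
  have hex (i : ℤ) : ∃ n, c n ≤ i ∧ i < c (n + 1) := by
    obtain ⟨n, h, h'⟩ := Int.exists_greatest_of_bdd (P := fun n => c n ≤ i)
      ⟨max 0 (i - c 0), fun z hz => by
        by_contra! hlt
        have := hmono' (show 0 ≤ z by omega)
        simp only at this
        omega⟩
      ⟨min 0 (i - c 0), by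
        have := hmono' (show min 0 (i - c 0) ≤ 0 by omega)
        simp only at this
        omega⟩
    refine ⟨n, h, ?_⟩
    by_contra! hlt
    have := h' _ hlt
    omega
  choose N hN hN' using hex
  have hNeq {i n : ℤ} (h : c n ≤ i) (h' : i < c (n + 1)) : N i = n := by
    have h1 := hmono.lt_iff_lt.1 (h.trans_lt (hN' i))
    have h2 := hmono.lt_iff_lt.1 ((hN i).trans_lt h')
    omega
  let x : ℤ → A := fun i =>
    (FreeMonoid.toList (f (FreeMonoid.of (y (N i))))).getD (i - c (N i)).toNat (y 0)
  have hletter (n : ℤ) :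
      window x (c n) (f (FreeMonoid.of (y n))).length = f (FreeMonoid.of (y n)) := by
    apply FreeMonoid.toList.injective
    refine List.ext_getElem (by simp [window, FreeMonoid.length]) fun j h h' => ?_
    have hj : j < (f (FreeMonoid.of (y n))).length := h'
    have hNj : N (c n + j) = n := hNeq (by omega) (by rw [hc]; omega)
    simp [window, x, hNj, h']
  have hlen (i : ℤ) (m : ℕ) : c (i + m) = c i + (f (window y i m)).length := by
    induction m with
    | zero => simp [window_zero]
    | succ m ih =>
      rw [window_succ, map_mul, FreeMonoid.length_mul, Nat.cast_succ, ← add_assoc, hc, ih,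
        Nat.cast_add, add_assoc]
  have hwin (i : ℤ) (m : ℕ) :
      window x (c i) (f (window y i m)).length = f (window y i m) := by
    induction m with
    | zero => simp [window_zero]
    | succ m ih =>
      rw [window_succ, map_mul, FreeMonoid.length_mul, window_add, ih, ← hlen, hletter]
  refine ⟨x, fun i m => ⟨c i, _, (hwin i m).symm⟩, ?_⟩
  rintro w ⟨i, m, rfl⟩
  have hle : N i < N (i + m) + 1 := hmono.lt_iff_lt.1 <|
    (hN i).trans_lt <| lt_of_le_of_lt (by omega) (hN' (i + m))
  obtain ⟨k, hk⟩ := Int.le.dest hle.le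
  refine ⟨N i, k, ?_⟩
  have h1 := hN i
  have h2 := hN' (i + m)
  rw [← hk, hlen] at h2
  obtain ⟨p, hp⟩ := Int.le.dest h1
  obtain ⟨q, hq⟩ := Int.le.dest h2.le
  rw [← hwin, show (f (window y (N i) k)).length = p + m + q by omega, window_add, window_add, hp]
  exact isFactor_of_eq rfl

end Image

/-! ### Desubstitution -/

section Marked

variable {A : Type*}

/-- The image of every letter under `f` begins with the letter `b`, and `b` does not occur
elsewhere in it. -/
def IsMarked (f : Morphism A) (b : A) : Prop :=
  ∀ a, ∃ t, b ∉ FreeMonoid.toList t ∧ f (FreeMonoid.of a) = FreeMonoid.of b * t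

theorem IsMarked.perm {f : Morphism A} {b : A} (h : IsMarked f b) (π π' : Equiv.Perm A) :
    IsMarked (permMorphism π * f * permMorphism π') (π b) := by
  intro a
  obtain ⟨t, ht, h⟩ := h (π' a)
  refine ⟨permMorphism π t, ?_, ?_⟩
  · rw [toList_permMorphism]
    simpa using ht
  · change permMorphism π (f (FreeMonoid.of (π' a))) = _
    rw [h, map_mul]
    rfl

/-- A word that begins with the marker can only be cut off an image at the boundary between the
images of two letters. -/
theorem IsMarked.exists_suffix {f : Morphism A} {b : A} (hf : IsMarked f b)
    {p q : FreeMonoid A} : ∀ {v : FreeMonoid A}, f v = p * (FreeMonoid.of b * q) →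
      ∃ v₁ v₂, v = v₁ * v₂ ∧ f v₂ = FreeMonoid.of b * q := by
  intro v
  induction v using FreeMonoid.inductionOn' generalizing p with
  | one =>
    intro h
    rw [map_one] at h
    exact absurd h.symm (List.append_ne_nil_of_right_ne_nil _ (List.cons_ne_nil _ _))
  | of_mul a v ih =>
    intro h
    cases p using FreeMonoid.casesOn with
    | one => exact ⟨1, _, (one_mul _).symm, by rw [h, one_mul]⟩
    | of_mul d p =>
      obtain ⟨t, ht, hat⟩ := hf a
      rw [map_mul, hat, mul_assoc, mul_assoc] at h
      obtain ⟨r, -, h2⟩ | ⟨r, h1, h2⟩ := exists_of_mul_eq_mul (of_mul_inj h).2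
      · obtain ⟨v₁, v₂, rfl, h3⟩ := ih h2
        exact ⟨_, v₂, (mul_assoc _ v₁ v₂).symm, h3⟩
      · cases r using FreeMonoid.casesOn with
        | one =>
          obtain ⟨v₁, v₂, rfl, h3⟩ := ih (p := 1) h2.symm
          exact ⟨_, v₂, (mul_assoc _ v₁ v₂).symm, h3⟩
        | of_mul e r =>
          rw [mul_assoc] at h2
          obtain rfl := (of_mul_inj h2).1
          exact absurd (h1 ▸ mem_mul_of_mul b p r) ht

theorem IsMarked.eq_one_or_exists_of_mul {f : Morphism A} {b : A} (hf : IsMarked f b)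
    (v : FreeMonoid A) : f v = 1 ∨ ∃ q, f v = FreeMonoid.of b * q := by
  cases v using FreeMonoid.casesOn with
  | one => exact .inl (map_one f)
  | of_mul e v =>
    obtain ⟨t, -, h⟩ := hf e
    exact .inr ⟨t * f v, by rw [map_mul, h, mul_assoc]⟩

/-- An image that begins with a word `b t`, followed by another marker `b`, comes from a word whose
first letter has image `b t`. -/
theorem IsMarked.exists_letter {f : Morphism A} {b : A} (hf : IsMarked f b)
    {v t q : FreeMonoid A} (ht : b ∉ FreeMonoid.toList t)
    (h : f v = FreeMonoid.of b * t * (FreeMonoid.of b * q)) :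
    ∃ a v', v = FreeMonoid.of a * v' ∧ f (FreeMonoid.of a) = FreeMonoid.of b * t ∧
      f v' = FreeMonoid.of b * q := by
  cases v using FreeMonoid.casesOn with
  | one =>
    rw [map_one] at h
    exact absurd h.symm (List.cons_ne_nil _ _)
  | of_mul a v =>
    obtain ⟨t', ht', hat⟩ := hf a
    rw [map_mul, hat, mul_assoc, mul_assoc] at h
    have key : t' = t ∧ f v = FreeMonoid.of b * q := by
      obtain ⟨r, h1, h2⟩ | ⟨r, h1, h2⟩ := exists_of_mul_eq_mul (of_mul_inj h).2
      · cases r using FreeMonoid.casesOn with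
        | one => exact ⟨by rw [h1, mul_one], h2⟩
        | of_mul d r =>
          obtain hv | ⟨q', hv⟩ := hf.eq_one_or_exists_of_mul v
          · rw [hv] at h2
            exact absurd h2.symm (of_mul_ne_one _ _)
          · rw [hv, mul_assoc] at h2
            obtain rfl := (of_mul_inj h2).1
            exact absurd (h1 ▸ mem_mul_of_mul b t' r) ht
      · cases r using FreeMonoid.casesOn with
        | one => exact ⟨by rw [h1, mul_one], h2.symm⟩
        | of_mul d r =>
          rw [mul_assoc] at h2
          obtain rfl := (of_mul_inj h2).1
          exact absurd (h1 ▸ mem_mul_of_mul b t r) ht'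
    exact ⟨a, v, rfl, by rw [hat, key.1], key.2⟩

/-- Between two consecutive markers `b` in an image, the word `b t` is the image of a letter. -/
theorem IsMarked.exists_eq_of_isFactor {f : Morphism A} {b : A} (hf : IsMarked f b)
    {v t : FreeMonoid A} (ht : b ∉ FreeMonoid.toList t)
    (h : IsFactor (FreeMonoid.of b * t * FreeMonoid.of b) (f v)) :
    ∃ a, f (FreeMonoid.of a) = FreeMonoid.of b * t := by
  obtain ⟨p, q, h⟩ := h.exists_eq
  obtain ⟨-, v₂, -, h⟩ := hf.exists_suffix (p := p) (q := t * FreeMonoid.of b * q)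
    (by rw [h]; simp only [mul_assoc])
  obtain ⟨a, -, -, h, -⟩ := hf.exists_letter ht (q := q) (h.trans (by simp only [mul_assoc]))
  exact ⟨a, h⟩

/-- Desubstitution at the beginning of an image; the marker after `f u` forces the last letter of
`u` to be read off completely. -/
theorem IsMarked.exists_prefix {f : Morphism A} {b : A} (hf : IsMarked f b)
    (hinj : ∀ a a', f (FreeMonoid.of a) = f (FreeMonoid.of a') → a = a') {u q : FreeMonoid A} :
    ∀ {v : FreeMonoid A}, f v = f u * (FreeMonoid.of b * q) → ∃ v', v = u * v' := by
  induction u using FreeMonoid.inductionOn' with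
  | one => exact fun {v} _ => ⟨v, (one_mul v).symm⟩
  | of_mul a u ih =>
    intro v h
    obtain ⟨t, ht, hat⟩ := hf a
    have hhead : ∃ q', f u * (FreeMonoid.of b * q) = FreeMonoid.of b * q' := by
      obtain hu | ⟨q', hu⟩ := hf.eq_one_or_exists_of_mul u
      · exact ⟨q, by rw [hu, one_mul]⟩
      · exact ⟨_, by rw [hu, mul_assoc]⟩
    obtain ⟨q', hq'⟩ := hhead
    obtain ⟨a', v, rfl, ha', hv⟩ := hf.exists_letter ht
      (h.trans (by rw [map_mul, hat, mul_assoc, hq']))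
    obtain rfl := hinj _ _ (ha'.trans hat.symm)
    obtain ⟨v', rfl⟩ := ih (hv.trans hq'.symm)
    exact ⟨v', (mul_assoc _ _ _).symm⟩

/-- Desubstitution: if `f v` contains `f u`, followed by the marker, then `v` contains `u`. -/
theorem IsMarked.isFactor_of_isFactor {f : Morphism A} {b : A} (hf : IsMarked f b)
    (hinj : ∀ a a', f (FreeMonoid.of a) = f (FreeMonoid.of a') → a = a') {u v : FreeMonoid A}
    (h : IsFactor (f u * FreeMonoid.of b) (f v)) : IsFactor u v := by
  obtain ⟨p, q, h⟩ := h.exists_eq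
  cases u using FreeMonoid.casesOn with
  | one => exact List.nil_infix
  | of_mul a u =>
    obtain ⟨t, ht, hat⟩ := hf a
    obtain ⟨v₁, v₂, rfl, h2⟩ := hf.exists_suffix (p := p) (q := t * f u * FreeMonoid.of b * q)
      (by rw [h, map_mul, hat]; simp only [mul_assoc])
    obtain ⟨v', rfl⟩ := hf.exists_prefix hinj (u := FreeMonoid.of a * u) (q := q)
      (h2.trans (by rw [map_mul, hat]; simp only [mul_assoc]))
    exact isFactor_of_eq (mul_assoc _ _ _).symm

end Marked

/-! ### Consecutive levels of a directive sequence -/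

section Levels

variable {A : Type*}

theorem block_succ' (σ : ℕ → Morphism A) (n k : ℕ) :
    block σ n (k + 1) = σ n * block σ (n + 1) k := by
  induction k with
  | zero => simp [block]
  | succ k ih =>
    rw [block, ih, block, mul_assoc, show n + (k + 1) = n + 1 + k by omega]

theorem mem_levelLanguage_of_isFactor {σ : ℕ → Morphism A} {n : ℕ} {v w : FreeMonoid A}
    (hv : v ∈ levelLanguage σ n) (hw : IsFactor w v) : w ∈ levelLanguage σ n := by
  obtain ⟨N, hN, a, h⟩ := hv
  exact ⟨N, hN, a, hw.trans h⟩

theorem mem_levelLanguage_of_succ {σ : ℕ → Morphism A} {n : ℕ} {v w : FreeMonoid A}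
    (hv : v ∈ levelLanguage σ (n + 1)) (hw : IsFactor w (σ n v)) : w ∈ levelLanguage σ n := by
  obtain ⟨N, hN, a, h⟩ := hv
  refine ⟨N, by omega, a, hw.trans ?_⟩
  rw [show N - n = N - (n + 1) + 1 by omega, block_succ']
  exact h.map (σ n)

theorem exists_of_mem_levelLanguage [Fintype A] {σ : ℕ → Morphism A} (hσ : IsDirective σ) {n : ℕ}
    {w : FreeMonoid A} (hw : w ∈ levelLanguage σ n) :
    ∃ v ∈ levelLanguage σ (n + 1), IsFactor w (σ n v) := by
  obtain ⟨N, hN, a, h⟩ := hw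
  rw [show N - n = N - (n + 1) + 1 by omega, block_succ'] at h
  obtain rfl | hN := (Nat.succ_le_of_lt hN).eq_or_lt
  · -- Here `w` is a factor of `σ n a`; the letter `a` occurs at level `n + 1` by minimality.
    obtain ⟨b, hb⟩ := hσ.minimal (n + 1) a
    refine ⟨FreeMonoid.of a, ⟨n + 2, by omega, b, ?_⟩, by simpa [block] using h⟩
    simpa [block] using hb
  · exact ⟨_, ⟨N, hN, a, List.infix_refl _⟩, h⟩

/-- A bi-infinite word of level `n + 1` has an image of level `n`. -/
theorem exists_image_mem_levelShift [Fintype A] {σ : ℕ → Morphism A} (hσ : IsDirective σ) {n : ℕ}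
    {y : ℤ → A} (hy : y ∈ levelShift σ (n + 1)) :
    ∃ x ∈ levelShift σ n, ∀ i m, σ n (window y i m) ∈ language x := by
  obtain ⟨x, h, h'⟩ := exists_image (hσ.nonerasing n) y
  refine ⟨x, fun w hw => ?_, h⟩
  obtain ⟨i, m, hw⟩ := h' w hw
  exact mem_levelLanguage_of_succ (hy ⟨i, m, rfl⟩) hw

/-- A bi-infinite word with an image of level `n` under `σ n` is of level `n + 1`. -/
theorem mem_levelShift_succ [Fintype A] {σ : ℕ → Morphism A} (hσ : IsDirective σ) {n : ℕ} {b : A}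
    (hb : IsMarked (σ n) b)
    (hinj : ∀ a a', σ n (FreeMonoid.of a) = σ n (FreeMonoid.of a') → a = a')
    {x y : ℤ → A} (hx : x ∈ levelShift σ n) (h : ∀ i m, σ n (window y i m) ∈ language x) :
    y ∈ levelShift σ (n + 1) := by
  rintro _ ⟨i, m, rfl⟩
  obtain ⟨v, hv, h⟩ := exists_of_mem_levelLanguage hσ (hx (h i (m + 1)))
  refine mem_levelLanguage_of_isFactor hv (hb.isFactor_of_isFactor hinj (.trans ?_ h))
  obtain ⟨t, -, ht⟩ := hb (y (i + m))
  rw [window_succ, map_mul, ht]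
  exact isFactor_of_eq (p := 1) (q := t) (by rw [one_mul, mul_assoc])

theorem map_mem_language_comp {π : Equiv.Perm A} {x : ℤ → A} {w : FreeMonoid A}
    (h : w ∈ language x) : permMorphism π w ∈ language (π ∘ x) := by
  obtain ⟨i, m, rfl⟩ := h
  exact ⟨i, m, (window_comp π x i m).symm⟩

/-- If the shifts of level `n` of two directive sequences agree up to the permutation `ξ`, and the
morphisms of level `n` agree up to `ξ` and `ξ'`, then the shifts of the next level agree up to
`ξ'`. -/
theorem levelShift_succ_iff [Fintype A] {ρ σ : ℕ → Morphism A} (hρ : IsDirective ρ)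
    (hσ : IsDirective σ) {n : ℕ} {b b' : A} (hb : IsMarked (ρ n) b) (hb' : IsMarked (σ n) b')
    (hinj : ∀ a a', ρ n (FreeMonoid.of a) = ρ n (FreeMonoid.of a') → a = a')
    (hinj' : ∀ a a', σ n (FreeMonoid.of a) = σ n (FreeMonoid.of a') → a = a')
    {ξ ξ' : Equiv.Perm A} (h : ∀ z, z ∈ levelShift σ n ↔ ⇑ξ ∘ z ∈ levelShift ρ n)
    (hξ : ρ n * permMorphism ξ' = permMorphism ξ * σ n) (z : ℤ → A) :
    z ∈ levelShift σ (n + 1) ↔ ⇑ξ' ∘ z ∈ levelShift ρ (n + 1) := by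
  have hξ (w : FreeMonoid A) : ρ n (permMorphism ξ' w) = permMorphism ξ (σ n w) :=
    DFunLike.congr_fun hξ w
  constructor <;> intro hz
  · obtain ⟨x, hx, hzx⟩ := exists_image_mem_levelShift hσ hz
    refine mem_levelShift_succ hρ hb hinj ((h x).1 hx) fun i m => ?_
    rw [window_comp, hξ]
    exact map_mem_language_comp (hzx i m)
  · obtain ⟨x, hx, hzx⟩ := exists_image_mem_levelShift hρ hz
    obtain ⟨x, rfl⟩ : ∃ x', x = ⇑ξ ∘ x' := ⟨⇑ξ⁻¹ ∘ x, by ext; simp⟩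
    refine mem_levelShift_succ hσ hb' hinj' ((h x).2 hx) fun i m => ?_
    have := map_mem_language_comp (π := ξ⁻¹) (hzx i m)
    rw [window_comp, hξ, permMorphism_inv_apply] at this
    convert this
    ext
    simp

end Levels

/-! ### The return morphisms -/

section Ternary

/-- The six shapes of morphisms in `S3`. -/
inductive Kind
  | alpha | beta | gamma | eta | delta | zeta
  deriving DecidableEq

namespace Kind

/-- The morphism of a given shape and exponent; the exponent is ignored except for
`delta` and `zeta`. -/
def morphism (k : ℕ) : Kind → Morphism A3
  | alpha => SAdic.alpha
  | beta => SAdic.beta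
  | gamma => SAdic.gamma
  | eta => SAdic.eta
  | delta => SAdic.delta k
  | zeta => SAdic.zeta k

/-- The pairs `(a, b)` such that the two-letter word `a b` occurs in `s(c) 1` for some letter `c`,
where `s` is a morphism of the given shape with a positive exponent (the entries `0`, `1`, `2` stand
for the letters `1`, `2`, `3`). -/
def pairs : Kind → List (A3 × A3)
  | alpha => [(0, 0), (0, 1), (0, 2), (1, 0), (2, 0)]
  | beta => [(0, 0), (0, 1), (1, 0), (0, 2), (2, 1)]
  | gamma => [(0, 0), (0, 1), (1, 0), (1, 2), (2, 0)]
  | eta => [(0, 2), (2, 0), (0, 1), (1, 0), (1, 2)]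
  | delta => [(0, 0), (2, 2), (0, 1), (1, 2), (2, 0)]
  | zeta => [(2, 2), (0, 2), (2, 0), (0, 1), (1, 0)]

/-- The two-letter words determine the shape, and, except for the exchange of the letters `2` and
`3` in `alpha`, also the names of the letters. -/
theorem eq_of_pairs_subset : ∀ (κ κ' : Kind) (θ : Equiv.Perm A3),
    (∀ p ∈ κ.pairs, (θ p.1, θ p.2) ∈ κ'.pairs) →
      κ = κ' ∧ (θ = 1 ∨ κ = .alpha ∧ θ = Equiv.swap 1 2) := by
  intro κ κ'
  cases κ <;> cases κ' <;> decide

theorem exists_of_mem_S3 {s : Morphism A3} (hs : s ∈ S3) :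
    ∃ k, 1 ≤ k ∧ ∃ κ : Kind, s = κ.morphism k := by
  obtain (rfl | rfl | rfl | rfl) | ⟨k, hk, rfl | rfl⟩ := hs
  exacts [⟨1, le_rfl, alpha, rfl⟩, ⟨1, le_rfl, beta, rfl⟩, ⟨1, le_rfl, gamma, rfl⟩,
    ⟨1, le_rfl, eta, rfl⟩, ⟨k, hk, delta, rfl⟩, ⟨k, hk, zeta, rfl⟩]

theorem toList_x3_pow (k : ℕ) : FreeMonoid.toList (x3 ^ k) = List.replicate k 2 := by
  induction k with
  | zero => rfl
  | succ k ih =>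
    rw [pow_succ', FreeMonoid.toList_mul, ih]
    rfl

/-- The images of the letters without their first letter `1`. -/
def tail (k : ℕ) : Kind → A3 → FreeMonoid A3
  | alpha => ![1, x2, x3]
  | beta => ![1, x2, x3 * x2]
  | gamma => ![1, x2, x2 * x3]
  | eta => ![x3, x2, x2 * x3]
  | delta => ![1, x2 * x3 ^ k, x2 * x3 ^ (k + 1)]
  | zeta => ![x3 ^ k, x2, x3 ^ (k + 1)]

theorem morphism_of (k : ℕ) (κ : Kind) (a : A3) :
    κ.morphism k (FreeMonoid.of a) = FreeMonoid.of 0 * κ.tail k a := by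
  cases κ <;> fin_cases a <;> rfl

theorem toList_tail (k : ℕ) (κ : Kind) (a : A3) :
    FreeMonoid.toList (κ.tail k a) = match κ with
      | alpha => ![[], [1], [2]] a
      | beta => ![[], [1], [2, 1]] a
      | gamma => ![[], [1], [1, 2]] a
      | eta => ![[2], [1], [1, 2]] a
      | delta => ![[], 1 :: List.replicate k 2, 1 :: List.replicate (k + 1) 2] a
      | zeta => ![List.replicate k 2, [1], List.replicate (k + 1) 2] a := by
  simp only [← toList_x3_pow]
  cases κ <;> fin_cases a <;> rfl

theorem notMem_tail (k : ℕ) (κ : Kind) (a : A3) : 0 ∉ FreeMonoid.toList (κ.tail k a) := by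
  rw [toList_tail]
  cases κ <;> fin_cases a <;> simp

theorem isMarked (k : ℕ) (κ : Kind) : IsMarked (κ.morphism k) 0 :=
  fun a => ⟨κ.tail k a, notMem_tail k κ a, morphism_of k κ a⟩

theorem tail_injective {k : ℕ} (hk : 1 ≤ k) (κ : Kind) : Function.Injective (κ.tail k) := by
  intro a b h
  replace h := congrArg FreeMonoid.toList h
  rw [toList_tail, toList_tail] at h
  obtain ⟨k, rfl⟩ := Nat.exists_eq_add_of_le' hk
  cases κ <;> fin_cases a <;> fin_cases b <;> simp [List.replicate_succ] at h ⊢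

/-- Every two-letter word in an image is in the list `pairs`. -/
theorem mem_pairs_of_isFactor {k : ℕ} (hk : 1 ≤ k) (κ : Kind) {a b : A3} {v : FreeMonoid A3}
    (h : IsFactor (FreeMonoid.of a * FreeMonoid.of b) (κ.morphism k v)) : (a, b) ∈ κ.pairs := by
  let R : A3 → A3 → Prop := fun a b => (a, b) ∈ κ.pairs
  have hletter (c : A3) :
      List.IsChain R (FreeMonoid.toList (κ.morphism k (FreeMonoid.of c)) ++ [0]) := by
    have hrep {R : A3 → A3 → Prop} (h : R 2 2) (h0 : R 2 0) (m : ℕ) :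
        List.IsChain R (2 :: (List.replicate m 2 ++ [0])) := by
      induction m with
      | zero => simpa using h0
      | succ m ih => exact List.isChain_cons.2 ⟨by simpa [List.replicate_succ] using h, ih⟩
    rw [morphism_of, FreeMonoid.toList_mul, toList_tail]
    obtain ⟨k, rfl⟩ := Nat.exists_eq_add_of_le' hk
    cases κ <;> fin_cases c <;> simp [R, pairs, List.replicate_succ]
    all_goals exact hrep (by simp) (by simp) k
  -- An image is followed by `1`, whatever comes next, so the property passes from the images of
  -- letters to the images of words.
  have hchain (v : FreeMonoid A3) :
      List.IsChain R (FreeMonoid.toList (κ.morphism k v) ++ [0]) := by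
    induction v using FreeMonoid.inductionOn' with
    | one =>
      rw [map_one]
      exact List.isChain_singleton _
    | of_mul c v ih =>
      rw [map_mul, FreeMonoid.toList_mul, List.append_assoc]
      obtain ⟨hc, -, hc'⟩ := List.isChain_append.1 (hletter c)
      refine List.isChain_append.2 ⟨hc, ih, fun d hd e he => hc' d hd e ?_⟩
      obtain hv | ⟨q, hv⟩ := (κ.isMarked k).eq_one_or_exists_of_mul v
      · simpa [hv] using he
      · simpa [hv] using he
  have := (hchain v).infix (List.IsInfix.trans h (List.infix_append' [] _ _))
  simpa [R] using this

/-- Every two-letter word in the list `pairs` occurs in the image of a letter followed by `1`. -/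
theorem exists_isFactor_of_mem_pairs {k : ℕ} (hk : 1 ≤ k) (κ : Kind) {p : A3 × A3}
    (hp : p ∈ κ.pairs) : ∃ c, IsFactor (FreeMonoid.of p.1 * FreeMonoid.of p.2)
      (κ.morphism k (FreeMonoid.of c) * FreeMonoid.of 0) := by
  simp only [morphism_of, IsFactor, FreeMonoid.toList_mul, toList_tail]
  obtain ⟨k, rfl⟩ := Nat.exists_eq_add_of_le' hk
  cases κ with
  | delta =>
    simp only [pairs, List.mem_cons, List.not_mem_nil, or_false] at hp
    obtain rfl | rfl | rfl | rfl | rfl := hp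
    exacts [⟨0, [], [], rfl⟩, ⟨2, [0, 1], List.replicate k 2 ++ [0], rfl⟩,
      ⟨2, [], List.replicate (k + 2) 2 ++ [0], rfl⟩,
      ⟨2, [0], List.replicate (k + 1) 2 ++ [0], rfl⟩,
      ⟨2, 0 :: 1 :: List.replicate (k + 1) 2, [], by simp [List.replicate_succ']⟩]
  | zeta =>
    simp only [pairs, List.mem_cons, List.not_mem_nil, or_false] at hp
    obtain rfl | rfl | rfl | rfl | rfl := hp
    exacts [⟨2, [0], List.replicate k 2 ++ [0], rfl⟩,
      ⟨2, [], List.replicate (k + 1) 2 ++ [0], rfl⟩,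
      ⟨2, 0 :: List.replicate (k + 1) 2, [], by simp [List.replicate_succ']⟩,
      ⟨1, [], [0], rfl⟩, ⟨1, [0], [], rfl⟩]
  | _ =>
    clear hk
    revert p
    dsimp only [pairs]
    decide

/-- The exponent is determined by the images of the letters: `k` and `k + 1` are the
positive numbers among the numbers of occurrences of the letter `3` in them. -/
theorem eq_exponent {k l : ℕ} (hk : 1 ≤ k) {κ : Kind} (hκ : κ = delta ∨ κ = zeta)
    (h : ∀ c, ∃ a, κ.tail k c = κ.tail l a) : k = l := by
  have hcount (c : A3) : ∃ a, (FreeMonoid.toList (κ.tail k c)).count 2 =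
      (FreeMonoid.toList (κ.tail l a)).count 2 :=
    (h c).imp fun a ha => by rw [ha]
  simp only [toList_tail] at hcount
  obtain rfl | rfl := hκ
  · obtain ⟨a, ha⟩ := hcount 1
    obtain ⟨b, hb⟩ := hcount 2
    fin_cases a <;> fin_cases b <;> simp at ha hb <;> omega
  · obtain ⟨a, ha⟩ := hcount 0
    obtain ⟨b, hb⟩ := hcount 2
    fin_cases a <;> fin_cases b <;> simp at ha hb <;> omega

/-- If, up to renaming the letters by `θ`, the images of the letters under one return morphism,
followed by `1`, occur in images under another one, then the two morphisms are equal and `θ`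
only permutes the images of the letters. -/
theorem morphism_eq_of_isFactor {k l : ℕ} (hk : 1 ≤ k) (hl : 1 ≤ l) {κ κ' : Kind}
    {θ : Equiv.Perm A3} (h : ∀ c, ∃ v, IsFactor
      (permMorphism θ (κ.morphism k (FreeMonoid.of c) * FreeMonoid.of 0)) (κ'.morphism l v)) :
    κ.morphism k = κ'.morphism l ∧
      ∃ θ', permMorphism θ * κ.morphism k = κ.morphism k * permMorphism θ' := by
  have hpairs : ∀ p ∈ κ.pairs, (θ p.1, θ p.2) ∈ κ'.pairs := fun p hp => by
    obtain ⟨c, hc⟩ := κ.exists_isFactor_of_mem_pairs hk hp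
    obtain ⟨v, hv⟩ := h c
    exact κ'.mem_pairs_of_isFactor hl ((hc.map (permMorphism θ)).trans hv)
  obtain ⟨rfl, rfl | ⟨rfl, rfl⟩⟩ := eq_of_pairs_subset κ κ' θ hpairs
  · refine ⟨?_, 1, by rw [permMorphism_one, one_mul, mul_one]⟩
    have htail (c : A3) : ∃ a, κ.tail k c = κ.tail l a := by
      obtain ⟨v, hv⟩ := h c
      rw [permMorphism_one, morphism_of] at hv
      obtain ⟨a, ha⟩ := (κ.isMarked l).exists_eq_of_isFactor (κ.notMem_tail k c) hv
      rw [morphism_of] at ha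
      exact ⟨a, (of_mul_inj ha).2.symm⟩
    cases κ with
    | delta => rw [eq_exponent hk (.inl rfl) htail]
    | zeta => rw [eq_exponent hk (.inr rfl) htail]
    | _ => rfl
  · refine ⟨rfl, Equiv.swap 1 2, FreeMonoid.hom_eq fun a => ?_⟩
    fin_cases a <;> rfl

end Kind

theorem isMarked_of_mem_S3 {s : Morphism A3} (hs : s ∈ S3) : IsMarked s 0 := by
  obtain ⟨k, -, κ, rfl⟩ := Kind.exists_of_mem_S3 hs
  exact κ.isMarked k

theorem injective_of_mem_S3 {s : Morphism A3} (hs : s ∈ S3) (π π' : Equiv.Perm A3) {a a' : A3}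
    (h : (permMorphism π * s * permMorphism π') (FreeMonoid.of a) =
      (permMorphism π * s * permMorphism π') (FreeMonoid.of a')) : a = a' := by
  obtain ⟨k, hk, κ, rfl⟩ := Kind.exists_of_mem_S3 hs
  have h := congrArg (permMorphism π⁻¹) h
  simp only [Morphism.mul_apply, permMorphism_inv_apply, permMorphism_of,
    Kind.morphism_of] at h
  exact π'.injective (κ.tail_injective hk (of_mul_inj h).2)

end Ternary

/-! ### Uniqueness of the representation -/

section Uniqueness

/-- If the shifts of level `n` agree up to a permutation, then so do the morphisms of level `n`
and the shifts of level `n + 1`. -/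
theorem exists_perm_levelShift_succ {ρ σ : ℕ → Morphism A3} (hρ : IsDirective ρ)
    (hσ : IsDirective σ) {n : ℕ} (hover : IsOver (levelShift ρ (n + 1)))
    {π π' ψ ψ' : Equiv.Perm A3} {s t : Morphism A3} (hs : s ∈ S3) (ht : t ∈ S3)
    (hρn : ρ n = permMorphism π * s * permMorphism π')
    (hσn : σ n = permMorphism ψ * t * permMorphism ψ')
    {ξ : Equiv.Perm A3} (h : ∀ z, z ∈ levelShift σ n ↔ ⇑ξ ∘ z ∈ levelShift ρ n) :
    s = t ∧ ∃ ξ' : Equiv.Perm A3, ρ n * permMorphism ξ' = permMorphism ξ * σ n ∧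
      ∀ z, z ∈ levelShift σ (n + 1) ↔ ⇑ξ' ∘ z ∈ levelShift ρ (n + 1) := by
  have hmρ : IsMarked (ρ n) (π 0) := hρn ▸ (isMarked_of_mem_S3 hs).perm π π'
  have hmσ : IsMarked (σ n) (ψ 0) := hσn ▸ (isMarked_of_mem_S3 ht).perm ψ ψ'
  obtain ⟨hst, θ', hθ'⟩ :
      s = t ∧ ∃ θ', permMorphism (ψ⁻¹ * ξ⁻¹ * π) * s = s * permMorphism θ' := by
    have hfactor (c : A3) : ∃ v, IsFactor
        (permMorphism (ψ⁻¹ * ξ⁻¹ * π) (s (FreeMonoid.of c) * FreeMonoid.of 0)) (t v) := by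
      obtain ⟨y, hy, hyc⟩ := hover (π'⁻¹ c)
      obtain ⟨i, hi⟩ := exists_eq_of_mem_language hyc
      obtain ⟨x, hx, hyx⟩ := exists_image_mem_levelShift hρ hy
      obtain ⟨x, rfl⟩ : ∃ x', x = ⇑ξ ∘ x' := ⟨⇑ξ⁻¹ ∘ x, by ext; simp⟩
      -- The image of the letter, followed by the marker, is a prefix of the image of a window of
      -- length two.
      have hwin : IsFactor (permMorphism π (s (FreeMonoid.of c) * FreeMonoid.of 0))
          (ρ n (window y i 2)) := by
        obtain ⟨u, -, hu⟩ := hmρ (y (i + 1))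
        refine isFactor_of_eq (p := 1) (q := u) ?_
        rw [one_mul, window_succ, window_one, map_mul, Nat.cast_one, hu, hi, hρn]
        simp [Morphism.mul_apply, permMorphism_of, mul_assoc]
      obtain ⟨j, m, hj⟩ := hyx i 2
      rw [window_comp] at hj
      obtain ⟨v, -, hv⟩ := exists_of_mem_levelLanguage hσ ((h x).2 hx ⟨j, m, rfl⟩)
      refine ⟨permMorphism ψ' v, ?_⟩
      have hfac := (hwin.map (permMorphism ξ⁻¹)).trans
        (by rwa [hj, permMorphism_inv_apply])
      have := hfac.map (permMorphism ψ⁻¹)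
      rw [hσn] at this
      simpa only [Morphism.mul_apply, permMorphism_mul, permMorphism_inv_apply] using this
    obtain ⟨k, hk, κ, rfl⟩ := Kind.exists_of_mem_S3 hs
    obtain ⟨l, hl, κ', rfl⟩ := Kind.exists_of_mem_S3 ht
    exact Kind.morphism_eq_of_isFactor hk hl hfactor
  subst hst
  have hξ' : ρ n * permMorphism (π'⁻¹ * θ'⁻¹ * ψ') = permMorphism ξ * σ n := by
    have hπ : permMorphism π = permMorphism ξ * permMorphism ψ * permMorphism (ψ⁻¹ * ξ⁻¹ * π) := by
      rw [← permMorphism_mul, ← permMorphism_mul]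
      congr 1
      group
    calc ρ n * permMorphism (π'⁻¹ * θ'⁻¹ * ψ')
        = permMorphism ξ * permMorphism ψ * (permMorphism (ψ⁻¹ * ξ⁻¹ * π) * s) *
            permMorphism (π' * (π'⁻¹ * θ'⁻¹ * ψ')) := by
          rw [hρn, permMorphism_mul π', ← mul_assoc _ _ s, ← hπ, mul_assoc _ (permMorphism π')]
      _ = permMorphism ξ * permMorphism ψ * s *
            permMorphism (θ' * (π' * (π'⁻¹ * θ'⁻¹ * ψ'))) := by
          rw [hθ', permMorphism_mul θ']
          simp only [mul_assoc]
      _ = permMorphism ξ * σ n := by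
          rw [hσn, show θ' * (π' * (π'⁻¹ * θ'⁻¹ * ψ')) = ψ' by group]
          simp only [mul_assoc]
  refine ⟨rfl, _, hξ', levelShift_succ_iff hρ hσ hmρ hmσ (fun a a' haa => ?_)
    (fun a a' haa => ?_) h hξ'⟩
  · rw [hρn] at haa
    exact injective_of_mem_S3 hs π π' haa
  · rw [hσn] at haa
    exact injective_of_mem_S3 hs ψ ψ' haa

/-- A representation is determined, up to permutations, by one all of whose levels are over the
full alphabet. -/
theorem eq_and_exists_perm_of_isOver {X : Set (ℤ → A3)} {ρ σ : ℕ → Morphism A3}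
    (hρ : IsRepresentation permS3perm ρ X) (hover : ∀ n, IsOver (levelShift ρ n))
    (hσ : IsRepresentation permS3perm σ X) {π π' ψ ψ' : ℕ → Equiv.Perm A3} {s t : ℕ → Morphism A3}
    (hs : ∀ n, s n ∈ S3 ∧ ρ n = permMorphism (π n) * s n * permMorphism (π' n))
    (ht : ∀ n, t n ∈ S3 ∧ σ n = permMorphism (ψ n) * t n * permMorphism (ψ' n)) :
    (∀ n, s n = t n) ∧ Equivalent ρ σ := by
  have hlevel (n : ℕ) : ∃ ξ : Equiv.Perm A3, block ρ 0 n * permMorphism ξ = block σ 0 n ∧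
      ∀ z, z ∈ levelShift σ n ↔ ⇑ξ ∘ z ∈ levelShift ρ n := by
    induction n with
    | zero =>
      refine ⟨1, by rw [permMorphism_one, mul_one]; rfl, fun z => ?_⟩
      rw [← hρ.eq_shift, ← hσ.eq_shift]
      rfl
    | succ n ih =>
      obtain ⟨ξ, hblock, h⟩ := ih
      obtain ⟨-, ξ', hξ', h'⟩ := exists_perm_levelShift_succ hρ.directive hσ.directive
        (hover (n + 1)) (hs n).1 (ht n).1 (hs n).2 (ht n).2 h
      refine ⟨ξ', ?_, h'⟩
      rw [block, block, ← hblock, zero_add, mul_assoc, hξ', mul_assoc]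
  refine ⟨fun n => ?_, fun n => (hlevel n).imp fun _ h => h.1⟩
  obtain ⟨ξ, -, h⟩ := hlevel n
  exact (exists_perm_levelShift_succ hρ.directive hσ.directive
    (hover (n + 1)) (hs n).1 (ht n).1 (hs n).2 (ht n).2 h).1

theorem IsRepresentation.exists_decomposition {X : Set (ℤ → A3)} {σ : ℕ → Morphism A3}
    (hσ : IsRepresentation permS3perm σ X) :
    ∃ (π π' : ℕ → Equiv.Perm A3) (s : ℕ → Morphism A3),
      ∀ n, s n ∈ S3 ∧ σ n = permMorphism (π n) * s n * permMorphism (π' n) := by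
  choose π π' s hs h using hσ.mem
  exact ⟨π, π', s, fun n => ⟨hs n, h n⟩⟩

theorem Equivalent.symm_trans {ρ σ τ : ℕ → Morphism A3} (h : Equivalent ρ σ)
    (h' : Equivalent ρ τ) : Equivalent σ τ := by
  intro n
  obtain ⟨ξ, hξ⟩ := h n
  obtain ⟨ξ', hξ'⟩ := h' n
  refine ⟨ξ⁻¹ * ξ', ?_⟩
  rw [← hξ, ← hξ', permMorphism_mul, mul_assoc, ← mul_assoc (permMorphism ξ),
    permMorphism_mul_inv, one_mul]

end Uniqueness

end SAdic

theorem mainTheorem9 (X : Set (ℤ → SAdic.A3))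
    (hX : ∃ ρ : ℕ → SAdic.Morphism SAdic.A3,
      SAdic.IsRepresentation SAdic.permS3perm ρ X ∧ ∀ n, SAdic.IsOver (SAdic.levelShift ρ n))
    (σ τ : ℕ → SAdic.Morphism SAdic.A3)
    (hσ : SAdic.IsRepresentation SAdic.permS3perm σ X)
    (hτ : SAdic.IsRepresentation SAdic.permS3perm τ X) :
    SAdic.Equivalent σ τ ∧
      ∀ (π π' ψ ψ' : ℕ → Equiv.Perm SAdic.A3) (s t : ℕ → SAdic.Morphism SAdic.A3),
        (∀ n, s n ∈ SAdic.S3 ∧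
          σ n = SAdic.permMorphism (π n) * s n * SAdic.permMorphism (π' n)) →
        (∀ n, t n ∈ SAdic.S3 ∧
          τ n = SAdic.permMorphism (ψ n) * t n * SAdic.permMorphism (ψ' n)) →
        ∀ n, s n = t n := by
  obtain ⟨ρ, hρ, hover⟩ := hX
  obtain ⟨_, _, _, hr⟩ := hρ.exists_decomposition
  obtain ⟨_, _, _, hs⟩ := hσ.exists_decomposition
  obtain ⟨_, _, _, ht⟩ := hτ.exists_decomposition
  refine ⟨(SAdic.eq_and_exists_perm_of_isOver hρ hover hσ hr hs).2.symm_trans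
    (SAdic.eq_and_exists_perm_of_isOver hρ hover hτ hr ht).2,
    fun π π' ψ ψ' s t hs ht n => ?_⟩
  rw [← (SAdic.eq_and_exists_perm_of_isOver hρ hover hσ hr hs).1 n,
    ← (SAdic.eq_and_exists_perm_of_isOver hρ hover hτ hr ht).1 n]
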